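/- For $m\in\mathbb N=\{1,2,3,\dots\}$ let $\Delta_m=\int_0^\infty \ln x\,\operatorname{sech}^m x\,\mathrm dx$, let $\mathbf G=\sum_{k\ge 0}\frac{(-1)^k}{(2k+1)^2}$ be Catalan's constant, and let $\psi=\Gamma'/\Gamma$ be the digamma function. Then for every natural number $n\ge 4$, $$ \begin{aligned} \Delta_n ={}& -\frac{4\mathbf G}{\pi(n-2)(n-1)}+\frac{n-2}{n-1}\,\Delta_{n-2} +\frac{1}{(n-2)(n-1)}\sum_{k=1}^{n-3}\int_0^1\!\!\int_0^1 \frac{\Gamma\left(\frac{a+b+k}{2}\right)}{k!}\Biggl[\sum_{j=0}^{k-1}\frac{2^{j-1}(k-j-1)!}{\Gamma\left(\frac{a+b+k-2j}{2}\right)}\\ &\qquad+\frac{2^{k-2}}{\Gamma\left(\frac{a+b-k}{2}\right)}\left(\psi\left(\frac{a+b-k}{4}\right)-\psi\left(\frac{a+b-k+2}{4}\right)\right)\Biggr]\mathrm da\,\mathrm db , \end{aligned} $$ where $1/\Gamma$ is taken to be $0$ at the poles of $\Gamma$, the integrands of the double integrals are defined for almost every $(a,b)\in[0,1]^2$ (off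 finitely many lines $a+b=\text{const}$), and all the integrals involved converge absolutely. -/

import Mathlib

namespace SechLog

/-- The integrand of `Δ_n`: `ln x · sech^n x`. -/
noncomputable def logSechPow (n : ℕ) (x : ℝ) : ℝ :=
  Real.log x * (1 / Real.cosh x) ^ n

/-- `Δ_n = ∫_0^∞ ln x · sech^n x dx`. -/
noncomputable def Delta (n : ℕ) : ℝ :=
  ∫ x in Set.Ioi (0 : ℝ), logSechPow n x

/-- Catalan's constant `G = ∑_{k ≥ 0} (-1)^k / (2k+1)^2` (an absolutely convergent series). -/
noncomputable def catalanConstant : ℝ :=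
  ∑' k : ℕ, (-1 : ℝ) ^ k / (2 * (k : ℝ) + 1) ^ 2

/-- The digamma function `ψ = Γ'/Γ` at a real argument. -/
noncomputable def digamma (x : ℝ) : ℝ :=
  (Complex.digamma (x : ℂ)).re

/-- The digamma function is real on the real line, so no information is lost by the real part. -/
theorem ofReal_digamma (x : ℝ) : ((digamma x : ℝ) : ℂ) = Complex.digamma (x : ℂ) := by
  unfold digamma
  rw [← Complex.conj_eq_iff_re, Complex.digamma_def, logDeriv_apply, map_div₀,
    ← Complex.Gamma_conj, Complex.conj_ofReal]
  have h : (starRingEnd ℂ) ∘ Complex.Gamma ∘ (starRingEnd ℂ) = Complex.Gamma := by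
    funext z
    simp [Complex.Gamma_conj]
  have h2 := congrFun (deriv_conj_conj (𝕜 := ℂ) (f := Complex.Gamma)) (x : ℂ)
  rw [h] at h2
  simp only [Function.comp_apply, Complex.conj_ofReal] at h2
  rw [← h2]

/-- The function of `(a, b)` in the `k`-th double integral of the reduction formula. At the points
with `a + b - k ∈ {0, -2, -4, …}` (finitely many lines `a + b = const`, a null set) one of the two
digamma values is at a pole; the value of the integrand there is immaterial. -/
noncomputable def kernel (k : ℕ) (a b : ℝ) : ℝ :=
  Real.Gamma ((a + b + k) / 2) / (k.factorial : ℝ) *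
    ((∑ j ∈ Finset.range k,
        (2 : ℝ) ^ ((j : ℤ) - 1) * ((k - j - 1).factorial : ℝ) /
          Real.Gamma ((a + b + k - 2 * j) / 2)) +
      (2 : ℝ) ^ ((k : ℤ) - 2) / Real.Gamma ((a + b - k) / 2) *
        (digamma ((a + b - k) / 4) - digamma ((a + b - k + 2) / 4)))

end SechLog

/-! Write `S_m` for `sechTanhDiv m` and `L_m` for `sechLaplace m`. Since `(sech^m)'' = m² sech^m -
m(m+1) sech^(m+2)`, multiplying by `log x` and integrating by parts once gives `m(m+1) Δ_(m+2) = m²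
Δ_m - S_m` (`mul_Delta_add_two`). With `m = n - 2`, it remains to evaluate `S_m`, which is done by
telescoping from `S_1`.

The start `S_1 = 4G/π` (`sechTanhDiv_one`) comes from writing `sinh x / x` as the mean of `cosh (t
x)` over `0 < t < 1`. The inner integral is the even part of `L_2`, which the digamma reflection
formula turns into `π t / (2 sin (π t / 2))`; the substitution `t = (4/π) arctan w` then produces
Catalan's constant.

For the differences, another integration by parts gives `S_(k+1) - S_k = ∫ (sech^k - sech^(k+1)) /
x²`. Averaging `exp (-(a+b-1) x)` over the unit square gives `(2 cosh x - 2) / x²`, so this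
difference is half the average of `L_(k+1) (a+b-1)`. Finally `kernel k a b = -L_(k+1) (a+b-1) / 2`
for almost every `(a, b)` (`kernel_eq_sechLaplace`), by induction on `k`; the base case is the
digamma formula for `L_1`. -/

namespace SechLog

open MeasureTheory Set Filter Topology

/-! ### Elementary facts about sech and tanh -/

/-- The hyperbolic secant. -/
noncomputable def sech (x : ℝ) : ℝ := 1 / Real.cosh x

theorem sech_pos (x : ℝ) : 0 < sech x := one_div_pos.2 (Real.cosh_pos x)

theorem sech_le_one (x : ℝ) : sech x ≤ 1 :=
  (div_le_one (Real.cosh_pos x)).2 (Real.one_le_cosh x)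

theorem sech_zero : sech 0 = 1 := by simp [sech]

theorem sech_le_two_mul_exp_neg (x : ℝ) : sech x ≤ 2 * Real.exp (-x) := by
  rw [sech, div_le_iff₀ (Real.cosh_pos x), Real.cosh_eq]
  have h : Real.exp (-x) * Real.exp x = 1 := by rw [← Real.exp_add]; simp
  nlinarith [mul_self_nonneg (Real.exp (-x))]

theorem sech_sq (x : ℝ) : sech x ^ 2 = 1 - Real.tanh x ^ 2 := by
  have h := (Real.cosh_pos x).ne'
  rw [sech, Real.tanh_eq_sinh_div_cosh]
  field_simp
  linarith [Real.cosh_sq x]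

theorem sech_mul_cosh (x : ℝ) : sech x * Real.cosh x = 1 :=
  one_div_mul_cancel (Real.cosh_pos x).ne'

theorem hasDerivAt_sech (x : ℝ) : HasDerivAt sech (-(sech x * Real.tanh x)) x := by
  have h := (Real.cosh_pos x).ne'
  refine ((hasDerivAt_const x (1 : ℝ)).div (Real.hasDerivAt_cosh x) h).congr_deriv ?_
  rw [sech, Real.tanh_eq_sinh_div_cosh]
  field_simp
  simp

theorem hasDerivAt_tanh (x : ℝ) : HasDerivAt Real.tanh (sech x ^ 2) x := by
  have h := (Real.cosh_pos x).ne'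
  have e : Real.tanh = fun x => Real.sinh x / Real.cosh x :=
    funext Real.tanh_eq_sinh_div_cosh
  rw [e]
  refine ((Real.hasDerivAt_sinh x).div (Real.hasDerivAt_cosh x) h).congr_deriv ?_
  rw [sech]
  field_simp
  linarith [Real.cosh_sq x]

theorem continuous_sech : Continuous sech :=
  continuous_iff_continuousAt.2 fun x => (hasDerivAt_sech x).continuousAt

theorem continuous_tanh : Continuous Real.tanh :=
  continuous_iff_continuousAt.2 fun x => (hasDerivAt_tanh x).continuousAt

theorem hasDerivAt_sech_pow (m : ℕ) (x : ℝ) :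
    HasDerivAt (fun x => sech x ^ m) (-(m * sech x ^ m * Real.tanh x)) x := by
  refine ((hasDerivAt_sech x).pow m).congr_deriv ?_
  cases m with
  | zero => simp
  | succ m => simp only [Nat.add_sub_cancel, pow_succ]; ring

theorem abs_tanh_le_abs (x : ℝ) : |Real.tanh x| ≤ |x| := by
  have h := (convex_univ (𝕜 := ℝ) (E := ℝ)).norm_image_sub_le_of_norm_hasDerivWithin_le
    (f := Real.tanh) (f' := fun x => sech x ^ 2) (C := 1) (x := 0) (y := x)
    (fun x _ => (hasDerivAt_tanh x).hasDerivWithinAt)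
    (fun x _ => by
      rw [Real.norm_of_nonneg (sq_nonneg _)]
      exact pow_le_one₀ (sech_pos x).le (sech_le_one x)) (mem_univ _) (mem_univ _)
  simpa using h

theorem tanh_nonneg {x : ℝ} (hx : 0 ≤ x) : 0 ≤ Real.tanh x := by
  rw [Real.tanh_eq_sinh_div_cosh]
  exact div_nonneg (Real.sinh_nonneg_iff.2 hx) (Real.cosh_pos x).le

/-- `1 - sech ≤ 1 - sech² = tanh² ≤ x²`. This tames the factor `1 / x²` near the origin later on. -/
theorem one_sub_sech_le_sq (x : ℝ) : 1 - sech x ≤ x ^ 2 := by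
  have h1 := sech_sq x
  have h2 : sech x ^ 2 ≤ sech x := by
    nlinarith [sech_pos x, sech_le_one x]
  have h3 : Real.tanh x ^ 2 ≤ x ^ 2 := sq_le_sq.2 (abs_tanh_le_abs x)
  linarith

/-! ### Laplace transforms of powers of sech -/

/-- The Laplace transform of `sech ^ m`. -/
noncomputable def sechLaplace (m : ℕ) (t : ℝ) : ℝ :=
  ∫ x in Ioi (0 : ℝ), Real.exp (-t * x) * sech x ^ m

theorem continuous_exp_mul_sech_pow (m : ℕ) (t : ℝ) :
    Continuous fun x => Real.exp (-t * x) * sech x ^ m := by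
  have := continuous_sech
  fun_prop

theorem exp_mul_sech_pow_le (m : ℕ) (t x : ℝ) :
    Real.exp (-t * x) * sech x ^ m ≤ 2 ^ m * Real.exp (-(t + m) * x) := by
  calc Real.exp (-t * x) * sech x ^ m
      ≤ Real.exp (-t * x) * (2 * Real.exp (-x)) ^ m := by
        gcongr
        · exact (sech_pos x).le
        · exact sech_le_two_mul_exp_neg x
    _ = 2 ^ m * Real.exp (-(t + m) * x) := by
        rw [mul_pow, ← Real.exp_nat_mul, mul_left_comm, ← Real.exp_add]
        ring_nf

theorem exp_mul_sech_pow_nonneg (m : ℕ) (t x : ℝ) :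
    0 ≤ Real.exp (-t * x) * sech x ^ m :=
  mul_nonneg (Real.exp_pos _).le (pow_nonneg (sech_pos x).le m)

theorem integrableOn_exp_mul_sech_pow {m : ℕ} {t : ℝ} (h : 0 < t + m) :
    IntegrableOn (fun x => Real.exp (-t * x) * sech x ^ m) (Ioi 0) := by
  refine ((exp_neg_integrableOn_Ioi 0 h).const_mul (2 ^ m)).mono'
    (continuous_exp_mul_sech_pow m t).aestronglyMeasurable (ae_of_all _ fun x => ?_)
  rw [Real.norm_of_nonneg (exp_mul_sech_pow_nonneg m t x)]
  exact exp_mul_sech_pow_le m t x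

theorem integrableOn_sech_pow {m : ℕ} (h : 0 < m) :
    IntegrableOn (fun x => sech x ^ m) (Ioi 0) := by
  simpa using integrableOn_exp_mul_sech_pow (m := m) (t := 0) (by simpa using h)

theorem tendsto_exp_mul_sech_pow {m : ℕ} {t : ℝ} (h : 0 < t + m) :
    Tendsto (fun x => Real.exp (-t * x) * sech x ^ m) atTop (𝓝 0) := by
  have h1 : Tendsto (fun x => 2 ^ m * Real.exp (-(t + m) * x)) atTop (𝓝 (2 ^ m * 0)) := by
    refine (Real.tendsto_exp_atBot.comp ?_).const_mul _
    exact tendsto_id.const_mul_atTop_of_neg (by linarith)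
  rw [mul_zero] at h1
  exact squeeze_zero (exp_mul_sech_pow_nonneg m t) (exp_mul_sech_pow_le m t) h1

theorem sechLaplace_nonneg (m : ℕ) (t : ℝ) : 0 ≤ sechLaplace m t :=
  setIntegral_nonneg measurableSet_Ioi fun x _ => exp_mul_sech_pow_nonneg m t x

/-- Integrate the derivative of `exp (-(t+1) x) sech^k x` over the half-line; `exp x * sech x = 1 +
tanh x` trades the tanh term for one more power of sech. -/
theorem succ_mul_sechLaplace {k : ℕ} {t : ℝ} (h : 0 < t + 1 + k) :
    (k : ℝ) * sechLaplace (k + 1) t = 1 - (t + 1 - k) * sechLaplace k (t + 1) := by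
  have hint1 := integrableOn_exp_mul_sech_pow (m := k) (t := t + 1) (by linarith)
  have hint2 := integrableOn_exp_mul_sech_pow (m := k + 1) (t := t) (by push_cast; linarith)
  have hd : ∀ x : ℝ, HasDerivAt (fun x => Real.exp (-(t + 1) * x) * sech x ^ k)
      (-((t + 1 - k) * (Real.exp (-(t + 1) * x) * sech x ^ k)
        + k * (Real.exp (-t * x) * sech x ^ (k + 1)))) x := by
    intro x
    have h1 : HasDerivAt (fun x => Real.exp (-(t + 1) * x))
        (Real.exp (-(t + 1) * x) * (-(t + 1) * 1)) x :=
      ((hasDerivAt_id x).const_mul _).exp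
    refine (h1.mul (hasDerivAt_sech_pow k x)).congr_deriv ?_
    have e1 : Real.exp (-t * x) = Real.exp (-(t + 1) * x) * Real.exp x := by
      rw [← Real.exp_add]; ring_nf
    have e2 : Real.exp x * sech x = 1 + Real.tanh x := by
      rw [← Real.cosh_add_sinh, Real.tanh_eq_sinh_div_cosh, sech]
      have := (Real.cosh_pos x).ne'
      field_simp
    rw [e1, pow_succ]
    linear_combination (k * Real.exp (-(t + 1) * x) * sech x ^ k) * e2
  have key := integral_Ioi_of_hasDerivAt_of_tendsto' (a := 0) (m := 0) (fun x _ => hd x)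
    ((hint1.const_mul _).add (hint2.const_mul _)).neg
    (tendsto_exp_mul_sech_pow (by linarith))
  rw [integral_neg, integral_add (hint1.const_mul _) (hint2.const_mul _), integral_const_mul,
    integral_const_mul] at key
  simp only [mul_zero, Real.exp_zero, sech_zero, one_pow, mul_one] at key
  unfold sechLaplace
  linarith

/-- The two exponentials add up to `2 exp (-t x) cosh x`, and the cosh cancels the sech. -/
theorem sechLaplace_one_add {t : ℝ} (ht : 0 < t) :
    sechLaplace 1 (t - 1) + sechLaplace 1 (t + 1) = 2 / t := by
  unfold sechLaplace
  rw [← integral_add (integrableOn_exp_mul_sech_pow (by push_cast; linarith))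
    (integrableOn_exp_mul_sech_pow (by push_cast; linarith))]
  have : ∀ x, Real.exp (-(t - 1) * x) * sech x ^ 1 + Real.exp (-(t + 1) * x) * sech x ^ 1
      = 2 * Real.exp ((-t) * x) := by
    intro x
    have e1 : Real.exp (-(t - 1) * x) = Real.exp (-t * x) * Real.exp x := by
      rw [← Real.exp_add]; ring_nf
    have e2 : Real.exp (-(t + 1) * x) = Real.exp (-t * x) * Real.exp (-x) := by
      rw [← Real.exp_add]; ring_nf
    have e3 := sech_mul_cosh x
    rw [Real.cosh_eq] at e3
    rw [e1, e2]
    linear_combination 2 * Real.exp (-t * x) * e3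
  simp_rw [this]
  rw [integral_const_mul, integral_exp_mul_Ioi (by linarith)]
  simp
  ring

theorem sechLaplace_one_le {t : ℝ} (ht : 0 < t) : sechLaplace 1 t ≤ 1 / t := by
  have h : ∫ x in Ioi (0 : ℝ), Real.exp ((-t) * x) = 1 / t := by
    rw [integral_exp_mul_Ioi (by linarith)]; simp
  rw [← h]
  refine setIntegral_mono_on (integrableOn_exp_mul_sech_pow (by push_cast; linarith))
    (exp_neg_integrableOn_Ioi 0 ht) measurableSet_Ioi fun x _ => ?_
  rw [pow_one]
  exact mul_le_of_le_one_right (Real.exp_pos _).le (sech_le_one x)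

theorem sechLaplace_two_add_neg {t : ℝ} (h0 : 0 < t) (h2 : t < 2) :
    sechLaplace 2 t + sechLaplace 2 (-t)
      = t * (sechLaplace 1 (t - 1) + sechLaplace 1 (1 - t)) := by
  have h3 := succ_mul_sechLaplace (k := 1) (t := t) (by push_cast; linarith)
  have h4 := succ_mul_sechLaplace (k := 1) (t := -t) (by push_cast; linarith)
  have h5 := sechLaplace_one_add h0
  rw [eq_div_iff h0.ne'] at h5
  rw [show -t + 1 = 1 - t by ring] at h4
  push_cast at h3 h4
  linear_combination h3 + h4 - h5

/-! ### The real digamma function: recurrence, monotonicity, reflection -/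

theorem digamma_add_one {x : ℝ} (hx : ∀ m : ℕ, x ≠ -m) : digamma (x + 1) = digamma x + 1 / x := by
  have h := Complex.digamma_apply_add_one (x : ℂ) fun m hm => hx m (by exact_mod_cast hm)
  have h' : ((digamma (x + 1) : ℝ) : ℂ) = ((digamma x + 1 / x : ℝ) : ℂ) := by
    rw [ofReal_digamma]
    push_cast
    rw [h, ofReal_digamma, one_div]
  exact_mod_cast h'

theorem hasDerivAt_Gamma {x : ℝ} (hx : ∀ m : ℕ, x ≠ -m) :
    HasDerivAt Real.Gamma (digamma x * Real.Gamma x) x := by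
  have h := (Complex.differentiableAt_Gamma (x : ℂ)
    fun m hm => hx m (by exact_mod_cast hm)).hasDerivAt.real_of_complex
  have h0 : (Real.Gamma x : ℂ) ≠ 0 := by exact_mod_cast Real.Gamma_ne_zero hx
  have e : deriv Complex.Gamma (x : ℂ) = ((digamma x * Real.Gamma x : ℝ) : ℂ) := by
    rw [Complex.ofReal_mul, ofReal_digamma, Complex.digamma_def, logDeriv_apply,
      ← Complex.Gamma_ofReal, div_mul_cancel₀]
    rwa [Complex.Gamma_ofReal]
  rw [e, Complex.ofReal_re] at h
  exact h

theorem ne_neg_natCast {x : ℝ} (hx : 0 < x) (m : ℕ) : x ≠ -m := by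
  have : (0 : ℝ) ≤ m := m.cast_nonneg
  linarith

theorem hasDerivAt_log_Gamma {x : ℝ} (hx : 0 < x) :
    HasDerivAt (Real.log ∘ Real.Gamma) (digamma x) x := by
  have h0 := (Real.Gamma_pos_of_pos hx).ne'
  refine ((hasDerivAt_Gamma (ne_neg_natCast hx)).log h0).congr_deriv ?_
  rw [mul_div_cancel_right₀ _ h0]

/-- Digamma is the derivative of the convex function `log Γ`. -/
theorem digamma_monotoneOn : MonotoneOn digamma (Ioi 0) := by
  intro x hx y hy hxy
  have h := Real.convexOn_log_Gamma.monotoneOn_deriv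
    (fun z hz => (hasDerivAt_log_Gamma hz).differentiableAt) hx hy hxy
  rwa [(hasDerivAt_log_Gamma hx).deriv, (hasDerivAt_log_Gamma hy).deriv] at h

/-- Differentiate Euler's reflection formula `Γ(x) Γ(1-x) = π / sin (π x)`. -/
theorem digamma_one_sub_sub_digamma {x : ℝ} (h0 : 0 < x) (h1 : x < 1) :
    digamma (1 - x) - digamma x = Real.pi * Real.cos (Real.pi * x) / Real.sin (Real.pi * x) := by
  have hs : ∀ y : ℝ, y ∈ Ioo (0 : ℝ) 1 → 0 < Real.sin (Real.pi * y) := fun y hy =>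
    Real.sin_pos_of_pos_of_lt_pi (mul_pos Real.pi_pos hy.1)
      (mul_lt_of_lt_one_right Real.pi_pos hy.2)
  have hd1 : HasDerivAt (fun y => Real.Gamma y * Real.Gamma (1 - y))
      ((digamma x - digamma (1 - x)) * (Real.Gamma x * Real.Gamma (1 - x))) x := by
    have hg : HasDerivAt (fun y => Real.Gamma (1 - y))
        (digamma (1 - x) * Real.Gamma (1 - x) * (-1)) x :=
      HasDerivAt.comp x (hasDerivAt_Gamma (ne_neg_natCast (by linarith)))
        ((hasDerivAt_id x).const_sub 1)
    refine ((hasDerivAt_Gamma (ne_neg_natCast h0)).mul hg).congr_deriv ?_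
    ring
  have hd2 : HasDerivAt (fun y => Real.pi / Real.sin (Real.pi * y))
      (-(Real.pi * (Real.cos (Real.pi * x) * Real.pi)) / Real.sin (Real.pi * x) ^ 2) x := by
    have hsin : HasDerivAt (fun y => Real.sin (Real.pi * y))
        (Real.cos (Real.pi * x) * (Real.pi * 1)) x :=
      ((hasDerivAt_id x).const_mul Real.pi).sin
    refine ((hasDerivAt_const x Real.pi).div hsin (hs x ⟨h0, h1⟩).ne').congr_deriv ?_
    simp
  have he : (fun y => Real.Gamma y * Real.Gamma (1 - y))
      = fun y => Real.pi / Real.sin (Real.pi * y) :=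
    funext Real.Gamma_mul_Gamma_one_sub
  rw [he] at hd1
  have h := hd1.unique hd2
  rw [Real.Gamma_mul_Gamma_one_sub] at h
  have hs0 := (hs x ⟨h0, h1⟩).ne'
  have hpi := Real.pi_ne_zero
  generalize Real.sin (Real.pi * x) = s at h hs0 ⊢
  field_simp at h ⊢
  linear_combination -h

theorem digamma_add_half_sub_mem {x : ℝ} (hx : 0 < x) :
    0 ≤ digamma (x + 1 / 2) - digamma x ∧ digamma (x + 1 / 2) - digamma x ≤ 1 / x := by
  have h1 := digamma_monotoneOn (a := x) (b := x + 1 / 2) hx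
    (by simp only [mem_Ioi]; linarith) (by linarith)
  have h2 := digamma_monotoneOn (a := x + 1 / 2) (b := x + 1)
    (by simp only [mem_Ioi]; linarith) (by simp only [mem_Ioi]; linarith) (by linarith)
  have h3 := digamma_add_one (ne_neg_natCast hx)
  constructor <;> linarith

/-! ### Closed forms for the first two Laplace transforms -/

/-- Both sides satisfy `f(s) + f(s+2) = 2/(s+1)` and decay at infinity. Their difference `d` changes
sign under `s ↦ s + 2`, so `|d|` is constant along `t + 2n` and must be zero. -/
theorem sechLaplace_one_eq_digamma {t : ℝ} (ht : -1 < t) :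
    sechLaplace 1 t = (digamma ((t + 3) / 4) - digamma ((t + 1) / 4)) / 2 := by
  set d : ℝ → ℝ := fun t =>
    sechLaplace 1 t - (digamma ((t + 3) / 4) - digamma ((t + 1) / 4)) / 2 with hd
  have hstep : ∀ s, -1 < s → d (s + 2) = -d s := by
    intro s hs
    have h1 := sechLaplace_one_add (t := s + 1) (by linarith)
    rw [show s + 1 - 1 = s by ring, show s + 1 + 1 = s + 2 by ring] at h1
    have h2 := digamma_add_one (ne_neg_natCast (show 0 < (s + 1) / 4 by linarith))
    have h3 : 1 / ((s + 1) / 4) = 2 * (2 / (s + 1)) := by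
      have : s + 1 ≠ 0 := by linarith
      field_simp; norm_num
    rw [h3] at h2
    simp only [hd]
    rw [show (s + 2 + 3) / 4 = (s + 1) / 4 + 1 by ring, show s + 2 + 1 = s + 3 by ring]
    linarith
  have habs : ∀ n : ℕ, |d (t + 2 * n)| = |d t| := by
    intro n
    induction n with
    | zero => simp
    | succ n ih =>
      rw [show t + 2 * ((n + 1 : ℕ) : ℝ) = (t + 2 * n) + 2 by push_cast; ring, hstep, abs_neg, ih]
      have : (0 : ℝ) ≤ n := n.cast_nonneg
      linarith
  have hbound : ∀ s, 0 < s → |d s| ≤ 3 / s := by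
    intro s hs
    have h1 := sechLaplace_one_le hs
    have h2 := sechLaplace_nonneg 1 s
    obtain ⟨h3, h4⟩ := digamma_add_half_sub_mem (show 0 < (s + 1) / 4 by linarith)
    rw [show (s + 1) / 4 + 1 / 2 = (s + 3) / 4 by ring] at h3 h4
    have h5 : 1 / ((s + 1) / 4) ≤ 4 * (1 / s) := by
      rw [mul_one_div, one_div_div]
      gcongr
      linarith
    have h6 : 3 / s = 3 * (1 / s) := by ring
    have h7 : 0 < 1 / s := by positivity
    rw [abs_le, h6]
    simp only [hd]
    constructor <;> linarith
  have hlim : Tendsto (fun n : ℕ => 3 / (t + 2 * (n : ℝ))) atTop (𝓝 0) :=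
    Tendsto.const_div_atTop
      (tendsto_atTop_add_const_left _ _
        (tendsto_natCast_atTop_atTop.const_mul_atTop (by norm_num))) _
  have hle : |d t| ≤ 0 := by
    refine ge_of_tendsto hlim ?_
    filter_upwards [eventually_ge_atTop 1] with n hn
    rw [← habs n]
    refine hbound _ ?_
    have : (1 : ℝ) ≤ n := by exact_mod_cast hn
    linarith
  have := abs_nonpos_iff.1 hle
  simp only [hd] at this
  linarith

theorem sechLaplace_two_add_neg_eq {t : ℝ} (h0 : 0 < t) (h2 : t < 2) :
    sechLaplace 2 t + sechLaplace 2 (-t)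
      = Real.pi * t / Real.sin (Real.pi * t / 2) := by
  rw [sechLaplace_two_add_neg h0 h2, sechLaplace_one_eq_digamma (by linarith),
    sechLaplace_one_eq_digamma (by linarith)]
  have h3 := digamma_one_sub_sub_digamma (x := t / 4) (by linarith) (by linarith)
  have h4 := digamma_one_sub_sub_digamma (x := (2 - t) / 4) (by linarith) (by linarith)
  rw [show 1 - t / 4 = (1 - t + 3) / 4 by ring] at h3
  rw [show 1 - (2 - t) / 4 = (t - 1 + 3) / 4 by ring,
    show Real.pi * ((2 - t) / 4) = Real.pi / 2 - Real.pi * (t / 4) by ring,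
    Real.cos_pi_div_two_sub, Real.sin_pi_div_two_sub] at h4
  rw [show Real.pi * t / 2 = 2 * (Real.pi * (t / 4)) by ring, Real.sin_two_mul,
    show (t - 1 + 1) / 4 = t / 4 by ring, show (1 - t + 1) / 4 = (2 - t) / 4 by ring]
  have hpi := Real.pi_pos
  have hs : Real.sin (Real.pi * (t / 4)) ≠ 0 :=
    (Real.sin_pos_of_pos_of_lt_pi (by positivity) (by nlinarith)).ne'
  have hc : Real.cos (Real.pi * (t / 4)) ≠ 0 :=
    (Real.cos_pos_of_mem_Ioo ⟨by nlinarith, by nlinarith⟩).ne'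
  have hsc := Real.sin_sq_add_cos_sq (Real.pi * (t / 4))
  have h5 : digamma ((t - 1 + 3) / 4) - digamma (t / 4)
      + (digamma ((1 - t + 3) / 4) - digamma ((2 - t) / 4)) =
      Real.pi * Real.cos (Real.pi * (t / 4)) / Real.sin (Real.pi * (t / 4))
      + Real.pi * Real.sin (Real.pi * (t / 4)) / Real.cos (Real.pi * (t / 4)) := by
    rw [← h3, ← h4]; ring
  generalize Real.sin (Real.pi * (t / 4)) = s at *
  generalize Real.cos (Real.pi * (t / 4)) = c at *
  rw [← add_div, h5]
  field_simp
  linear_combination hsc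

/-! ### The kernel as a Laplace transform -/

theorem kernel_eq_kernel_add (k : ℕ) (a b : ℝ) : kernel k a b = kernel k (a + b) 0 := by
  simp only [kernel, add_zero]

theorem kernel_zero {t : ℝ} (ht : ∀ m : ℕ, t / 2 ≠ -m) :
    kernel 0 t 0 = (digamma (t / 4) - digamma ((t + 2) / 4)) / 4 := by
  have h := Real.Gamma_ne_zero ht
  simp only [kernel, add_zero, Nat.cast_zero, sub_zero, Finset.range_zero, Finset.sum_empty,
    Nat.factorial_zero, Nat.cast_one, div_one, zero_add]
  rw [zpow_sub₀ (by norm_num)]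
  field_simp
  norm_num

/-- Shifting the summation index matches every term with `j ≥ 1`, as well as the digamma term, with
its counterpart in the kernel of order `k` at `t - 1`. The leftover `j = 0` term gives the constant
`1/2`. -/
theorem kernel_succ (k : ℕ) {t : ℝ} (ht : ∀ m : ℤ, t ≠ m) :
    (k + 1 : ℝ) * kernel (k + 1) t 0 = 1 / 2 + (t + k - 1) * kernel k (t - 1) 0 := by
  have hne : ∀ j : ℤ, (t + j) / 2 ≠ 0 := by
    intro j hj
    refine ht (-j) ?_
    push_cast
    linarith
  have hG : Real.Gamma ((t + (k + 1)) / 2)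
      = (t + k - 1) / 2 * Real.Gamma ((t - 1 + k) / 2) := by
    rw [show (t + (k + 1)) / 2 = (t + k - 1) / 2 + 1 by ring, Real.Gamma_add_one]
    · ring_nf
    · have := hne (k - 1)
      push_cast at this
      rwa [add_sub_assoc]
  have hG0 : Real.Gamma ((t + (k + 1)) / 2) ≠ 0 := by
    refine Real.Gamma_ne_zero fun m hm => ?_
    have := hne (k + 1 + 2 * m)
    push_cast at this
    exact this (by linarith)
  have hk : ((k : ℝ) + 1) ≠ 0 := by positivity
  have hf : (k.factorial : ℝ) ≠ 0 := by exact_mod_cast k.factorial_ne_zero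
  have hsum : ∑ j ∈ Finset.range (k + 1), (2 : ℝ) ^ ((j : ℤ) - 1) *
        ((k + 1 - j - 1).factorial : ℝ) / Real.Gamma ((t + (k + 1) - 2 * j) / 2)
      = 2 * (∑ j ∈ Finset.range k, (2 : ℝ) ^ ((j : ℤ) - 1) * ((k - j - 1).factorial : ℝ) /
          Real.Gamma ((t - 1 + k - 2 * j) / 2))
        + 1 / 2 * k.factorial / Real.Gamma ((t + (k + 1)) / 2) := by
    rw [Finset.sum_range_succ', Finset.mul_sum]
    congr 1
    · refine Finset.sum_congr rfl fun j _ => ?_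
      rw [show k + 1 - (j + 1) - 1 = k - j - 1 by omega,
        show (((j + 1 : ℕ) : ℤ) - 1) = (j : ℤ) - 1 + 1 by push_cast; ring,
        zpow_add_one₀ (by norm_num)]
      rw [show (t + (k + 1) - 2 * ((j + 1 : ℕ) : ℝ)) / 2 = (t - 1 + k - 2 * j) / 2 by
        push_cast; ring]
      ring
    · simp
  simp only [kernel, add_zero, Nat.cast_add, Nat.cast_one, Nat.factorial_succ, Nat.cast_mul]
  rw [hsum, show ((k : ℤ) + 1 - 2) = (k : ℤ) - 2 + 1 by ring, zpow_add_one₀ (by norm_num),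
    show t - (k + 1) = t - 1 - k by ring]
  rw [hG] at hG0 ⊢
  have h1 := left_ne_zero_of_mul hG0
  have h2 := right_ne_zero_of_mul hG0
  generalize Real.Gamma ((t - 1 + k) / 2) = g at *
  generalize (∑ j ∈ Finset.range k, (2 : ℝ) ^ ((j : ℤ) - 1) * ((k - j - 1).factorial : ℝ) /
          Real.Gamma ((t - 1 + k - 2 * j) / 2)) = S
  generalize (2 : ℝ) ^ ((k : ℤ) - 2) = z
  generalize digamma ((t - 1 - k) / 4) - digamma ((t - 1 - k + 2) / 4) = D
  generalize Real.Gamma ((t - 1 - k) / 2) = g'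
  have h3 : t + k - 1 ≠ 0 := by intro h; rw [h] at h1; simp at h1
  field_simp
  ring

theorem kernel_contiguous (k : ℕ) : ∀ {t : ℝ}, (∀ m : ℤ, t ≠ m) →
    (t + k) * kernel k t 0 + (t - k) * kernel k (t + 2) 0 = -1 := by
  induction k with
  | zero =>
    intro t ht
    have h1 : ∀ m : ℕ, t / 2 ≠ -m := fun m hm => ht (-2 * m) (by push_cast; linarith)
    have h2 : ∀ m : ℕ, (t + 2) / 2 ≠ -m := fun m hm => ht (-2 * m - 2) (by push_cast; linarith)
    have h3 : ∀ m : ℕ, t / 4 ≠ -m := fun m hm => ht (-4 * m) (by push_cast; linarith)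
    have h4 : t ≠ 0 := by exact_mod_cast ht 0
    rw [kernel_zero h1, kernel_zero h2, show (t + 2 + 2) / 4 = t / 4 + 1 by ring,
      digamma_add_one h3]
    push_cast
    field_simp
    ring
  | succ k ih =>
    intro t ht
    have h1 := kernel_succ k ht
    have h2 := kernel_succ k (t := t + 2) fun m hm => ht (m - 2) (by push_cast; linarith)
    have h3 := ih (t := t - 1) fun m hm => ht (m + 1) (by push_cast; linarith)
    rw [show t - 1 + 2 = t + 1 by ring] at h3
    rw [show t + 2 - 1 = t + 1 by ring] at h2
    have hk : ((k : ℝ) + 1) ≠ 0 := by positivity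
    refine mul_left_cancel₀ hk ?_
    push_cast
    linear_combination (t + (k + 1)) * h1 + (t - (k + 1)) * h2 + (t + (k + 1)) * h3

/-- The recursions in `k` move the argument in opposite directions: `kernel_succ` leads to `kernel k
t 0`, `succ_mul_sechLaplace` to `kernel k (t + 2) 0` through the induction hypothesis.
`kernel_contiguous` links these two values. -/
theorem kernel_eq_sechLaplace (k : ℕ) : ∀ {t : ℝ}, (∀ m : ℤ, t ≠ m) → 0 < t + k + 1 →
    kernel k (t + 1) 0 = -(sechLaplace (k + 1) t / 2) := by
  induction k with
  | zero =>
    intro t ht h0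
    rw [Nat.cast_zero] at h0
    rw [kernel_zero fun m hm => ht (-2 * m - 1) (by push_cast; linarith),
      sechLaplace_one_eq_digamma (by linarith), show t + 1 + 2 = t + 3 by ring]
    ring
  | succ k ih =>
    intro t ht h0
    push_cast at h0
    have hint : ∀ m : ℤ, t + 1 ≠ m := fun m hm => ht (m - 1) (by push_cast; linarith)
    have h1 := kernel_succ k hint
    have h2 := kernel_contiguous k ht
    have h3 := ih hint (by linarith)
    have h4 := succ_mul_sechLaplace (k := k + 1) (t := t) (by push_cast; linarith)
    rw [show t + 1 - 1 = t by ring] at h1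
    rw [show t + 1 + 1 = t + 2 by ring] at h3
    have hk : ((k : ℝ) + 1) ≠ 0 := by positivity
    refine mul_left_cancel₀ hk ?_
    push_cast at h4 ⊢
    linear_combination h1 + h2 - (t - k) * h3 + h4 / 2

/-! ### Integrals giving Catalan's constant -/

theorem summable_one_div_odd_sq : Summable fun k : ℕ => 1 / (2 * (k : ℝ) + 1) ^ 2 := by
  have h := (summable_nat_add_iff 1).2 (Real.summable_one_div_nat_pow.2 one_lt_two)
  refine h.of_nonneg_of_le (fun k => by positivity) fun k => ?_
  have : (0 : ℝ) ≤ k := k.cast_nonneg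
  push_cast
  gcongr
  linarith

/-- Termwise integration of the arctan series, justified by absolute convergence; working on the
open interval keeps `|w| < 1`. -/
theorem integral_arctan_div : ∫ w in (0 : ℝ)..1, Real.arctan w / w = catalanConstant := by
  have hpow : ∀ k : ℕ, ∫ w in Ioo (0 : ℝ) 1, w ^ (2 * k) / (2 * (k : ℝ) + 1)
      = 1 / (2 * (k : ℝ) + 1) ^ 2 := by
    intro k
    rw [← integral_Ioc_eq_integral_Ioo, ← intervalIntegral.integral_of_le zero_le_one,
      intervalIntegral.integral_div, integral_pow]
    have : 2 * (k : ℝ) + 1 ≠ 0 := by positivity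
    push_cast
    field_simp
    simp
  have hint : ∀ k : ℕ, Integrable (fun w : ℝ => (-1) ^ k * (w ^ (2 * k) / (2 * (k : ℝ) + 1)))
      (volume.restrict (Ioo 0 1)) := fun k =>
    ((by fun_prop : Continuous fun w : ℝ =>
      (-1) ^ k * (w ^ (2 * k) / (2 * (k : ℝ) + 1))).integrableOn_Icc (a := 0) (b := 1)).mono_set
      Ioo_subset_Icc_self
  have hnorm : ∀ k : ℕ, ∫ w in Ioo (0 : ℝ) 1, ‖(-1) ^ k * (w ^ (2 * k) / (2 * (k : ℝ) + 1))‖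
      = 1 / (2 * (k : ℝ) + 1) ^ 2 := by
    intro k
    rw [← hpow k]
    refine setIntegral_congr_fun measurableSet_Ioo fun w hw => ?_
    have : 0 ≤ w ^ (2 * k) / (2 * (k : ℝ) + 1) := div_nonneg (pow_nonneg hw.1.le _) (by positivity)
    simp only [norm_mul, norm_pow, norm_neg, norm_one, one_pow, one_mul]
    rw [Real.norm_of_nonneg this]
  have h := integral_tsum_of_summable_integral_norm hint
    (by simp_rw [hnorm]; exact summable_one_div_odd_sq)
  rw [intervalIntegral.integral_of_le zero_le_one, integral_Ioc_eq_integral_Ioo, catalanConstant]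
  simp_rw [integral_const_mul, hpow] at h
  simp_rw [mul_one_div] at h
  rw [h]
  refine setIntegral_congr_fun measurableSet_Ioo fun w hw => ?_
  have hw1 : ‖w‖ < 1 := by rw [Real.norm_of_nonneg hw.1.le]; exact hw.2
  have hs := (Real.hasSum_arctan hw1).div_const w
  refine (hs.congr_fun ?_).tsum_eq.symm
  intro k
  have := hw.1.ne'
  push_cast
  field_simp
  ring

theorem integral_pi_mul_div_sin :
    ∫ t in (0 : ℝ)..1, Real.pi * t / Real.sin (Real.pi * t / 2)
      = 8 * catalanConstant / Real.pi := by
  have hpi := Real.pi_pos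
  set f : ℝ → ℝ := fun w => 4 / Real.pi * Real.arctan w with hf
  have hsin : ∀ u, 0 < u → u ≤ 1 → 0 < Real.sin (Real.pi * u / 2) := fun u h0 h1 =>
    Real.sin_pos_of_pos_of_lt_pi (by positivity) (by nlinarith)
  have hmaps : f '' uIcc 0 1 ⊆ Icc 0 1 := by
    rintro _ ⟨w, hw, rfl⟩
    rw [uIcc_of_le zero_le_one] at hw
    have h1 := Real.arctan_nonneg.2 hw.1
    have h2 := Real.arctan_strictMono.monotone hw.2
    rw [Real.arctan_one] at h2
    refine ⟨by positivity, ?_⟩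
    calc f w ≤ 4 / Real.pi * (Real.pi / 4) := by simp only [hf]; gcongr
      _ = 1 := by field_simp
  -- Writing the integrand with `sinc` removes its singularity at 0, where the quotient form has the
  -- value `0/0 = 0` instead of the limit 2.
  have hg : ContinuousOn (fun u => 2 / Real.sinc (Real.pi * u / 2)) (f '' uIcc 0 1) := by
    refine continuousOn_const.div
      (Real.continuous_sinc.comp (by fun_prop : Continuous fun u => Real.pi * u / 2)).continuousOn
      fun u hu => ?_
    obtain ⟨h0, h1⟩ := hmaps hu
    rcases h0.eq_or_lt with rfl | h0
    · simp
    · rw [Real.sinc_of_ne_zero (by positivity)]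
      exact div_ne_zero (hsin u h0 h1).ne' (by positivity)
  have hsub := intervalIntegral.integral_comp_mul_deriv' (a := 0) (b := 1) (f := f)
    (f' := fun w => 4 / Real.pi * (1 / (1 + w ^ 2))) (g := fun u => 2 / Real.sinc (Real.pi * u / 2))
    (fun w _ => (Real.hasDerivAt_arctan w).const_mul _)
    (Continuous.continuousOn <| continuous_const.mul <|
      continuous_const.div (by fun_prop) fun w => by positivity) hg
  have hf0 : f 0 = 0 := by simp [hf]
  have hf1 : f 1 = 1 := by simp only [hf, Real.arctan_one]; field_simp
  rw [hf0, hf1] at hsub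
  have hl : ∫ t in (0 : ℝ)..1, Real.pi * t / Real.sin (Real.pi * t / 2)
      = ∫ t in (0 : ℝ)..1, 2 / Real.sinc (Real.pi * t / 2) := by
    rw [intervalIntegral.integral_of_le zero_le_one, intervalIntegral.integral_of_le zero_le_one]
    refine setIntegral_congr_fun measurableSet_Ioc fun t ht => ?_
    have h1 := hsin t ht.1 ht.2
    have h0 := ht.1
    rw [Real.sinc_of_ne_zero (by positivity)]
    field_simp
  rw [hl, ← hsub, mul_div_right_comm, ← integral_arctan_div, ← intervalIntegral.integral_const_mul]
  rw [intervalIntegral.integral_of_le zero_le_one, intervalIntegral.integral_of_le zero_le_one]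
  refine setIntegral_congr_fun measurableSet_Ioc fun w hw => ?_
  have hw0 := hw.1
  have ha := Real.arctan_pos.2 hw0
  have hs : Real.sin (2 * Real.arctan w) = 2 * w / (1 + w ^ 2) := by
    rw [Real.sin_two_mul, Real.sin_arctan, Real.cos_arctan]
    have h1 : √(1 + w ^ 2) ^ 2 = 1 + w ^ 2 := Real.sq_sqrt (by positivity)
    have h2 : √(1 + w ^ 2) ≠ 0 := by positivity
    field_simp
    rw [h1]
  have he : Real.pi * f w / 2 = 2 * Real.arctan w := by simp only [hf]; field_simp; norm_num
  simp only [Function.comp_apply]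
  rw [he, Real.sinc_of_ne_zero (by positivity), hs]
  field_simp
  norm_num

/-! ### The starting value of the telescoping sum -/

/-- The integral `∫_0^∞ m sech^m x tanh x / x dx`. -/
noncomputable def sechTanhDiv (m : ℕ) : ℝ :=
  ∫ x in Ioi (0 : ℝ), m * sech x ^ m * Real.tanh x / x

theorem integral_cosh_mul {x : ℝ} (hx : x ≠ 0) :
    ∫ t in (0 : ℝ)..1, Real.cosh (t * x) = Real.sinh x / x := by
  rw [intervalIntegral.integral_comp_mul_right (fun y => Real.cosh y) hx]
  rw [intervalIntegral.integral_eq_sub_of_hasDerivAt (f := Real.sinh)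
    (fun y _ => Real.hasDerivAt_sinh y) (Real.continuous_cosh.intervalIntegrable _ _)]
  simp
  ring

theorem cosh_mul_sech_sq (t x : ℝ) : Real.cosh (t * x) * sech x ^ 2
    = (Real.exp (-t * x) * sech x ^ 2 + Real.exp (-(-t) * x) * sech x ^ 2) / 2 := by
  rw [Real.cosh_eq, neg_mul, neg_neg]
  ring

theorem integrableOn_cosh_mul_sech_sq {t : ℝ} (h : |t| < 2) :
    IntegrableOn (fun x => Real.cosh (t * x) * sech x ^ 2) (Ioi 0) := by
  simp_rw [cosh_mul_sech_sq]
  rw [abs_lt] at h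
  exact ((integrableOn_exp_mul_sech_pow (by push_cast; linarith)).add
    (integrableOn_exp_mul_sech_pow (by push_cast; linarith))).div_const 2

theorem integral_cosh_mul_sech_sq {t : ℝ} (h0 : 0 < t) (h : t < 2) :
    ∫ x in Ioi (0 : ℝ), Real.cosh (t * x) * sech x ^ 2
      = Real.pi * t / Real.sin (Real.pi * t / 2) / 2 := by
  rw [← sechLaplace_two_add_neg_eq h0 h]
  simp_rw [cosh_mul_sech_sq]
  rw [integral_div, integral_add (integrableOn_exp_mul_sech_pow (by push_cast; linarith))
    (integrableOn_exp_mul_sech_pow (by push_cast; linarith))]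
  rfl

theorem sechTanhDiv_one : sechTanhDiv 1 = 4 * catalanConstant / Real.pi := by
  have hswap : Integrable (Function.uncurry fun t x : ℝ => Real.cosh (t * x) * sech x ^ 2)
      ((volume.restrict (Ioo 0 1)).prod (volume.restrict (Ioi 0))) := by
    -- The dominating function is the value at `t = 1`, since cosh increases on the half-line.
    have hb : Integrable (fun p : ℝ × ℝ => (1 : ℝ) * (Real.cosh (1 * p.2) * sech p.2 ^ 2))
        ((volume.restrict (Ioo 0 1)).prod (volume.restrict (Ioi 0))) :=
      (integrable_const (1 : ℝ)).mul_prod (integrableOn_cosh_mul_sech_sq (by norm_num))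
    have hc := continuous_sech
    refine hb.mono' (by
      unfold Function.uncurry
      exact (by fun_prop : Continuous fun p : ℝ × ℝ =>
        Real.cosh (p.1 * p.2) * sech p.2 ^ 2).aestronglyMeasurable) ?_
    rw [Measure.prod_restrict]
    filter_upwards [ae_restrict_mem (measurableSet_Ioo.prod measurableSet_Ioi)] with p hp
    obtain ⟨⟨h1, h2⟩, h3⟩ := hp
    have h3 : 0 < p.2 := h3
    have hs := sq_nonneg (sech p.2)
    rw [Function.uncurry, Real.norm_of_nonneg (mul_nonneg (Real.cosh_pos _).le hs), one_mul]
    refine mul_le_mul_of_nonneg_right (Real.cosh_le_cosh.2 ?_) hs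
    rw [abs_of_pos (by positivity), abs_of_pos (by linarith)]
    exact mul_le_mul_of_nonneg_right h2.le h3.le
  have h := integral_integral_swap hswap
  have hl : ∫ t in Ioo (0 : ℝ) 1, ∫ x in Ioi (0 : ℝ), Real.cosh (t * x) * sech x ^ 2
      = 4 * catalanConstant / Real.pi := by
    rw [setIntegral_congr_fun measurableSet_Ioo fun t ht =>
      integral_cosh_mul_sech_sq ht.1 (ht.2.trans one_lt_two), integral_div,
      ← integral_Ioc_eq_integral_Ioo, ← intervalIntegral.integral_of_le zero_le_one,
      integral_pi_mul_div_sin]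
    ring
  rw [hl] at h
  rw [h, sechTanhDiv]
  refine setIntegral_congr_fun measurableSet_Ioi fun x hx => ?_
  have hx : x ≠ 0 := (mem_Ioi.1 hx).ne'
  have hc := (Real.cosh_pos x).ne'
  rw [integral_mul_const, ← integral_Ioc_eq_integral_Ioo,
    ← intervalIntegral.integral_of_le zero_le_one, integral_cosh_mul hx, sech,
    Real.tanh_eq_sinh_div_cosh]
  field_simp
  exact Nat.cast_one

/-! ### Integration by parts against the logarithm -/

theorem tanh_div_nonneg {x : ℝ} (hx : 0 < x) : 0 ≤ Real.tanh x / x :=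
  div_nonneg (tanh_nonneg hx.le) hx.le

theorem tanh_div_le_one {x : ℝ} (hx : 0 < x) : Real.tanh x / x ≤ 1 := by
  rw [div_le_one hx]
  have := abs_tanh_le_abs x
  rw [abs_of_pos hx] at this
  exact (le_abs_self _).trans this

theorem continuousOn_sech_pow_mul_tanh_div (m : ℕ) :
    ContinuousOn (fun x => m * sech x ^ m * Real.tanh x / x) (Ioi 0) := by
  have h1 := continuous_sech
  have h2 := continuous_tanh
  exact ContinuousOn.div (by fun_prop) continuousOn_id fun x hx => (mem_Ioi.1 hx).ne'

theorem integrableOn_sech_pow_mul_tanh_div {m : ℕ} (hm : 0 < m) :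
    IntegrableOn (fun x => m * sech x ^ m * Real.tanh x / x) (Ioi 0) := by
  refine ((integrableOn_sech_pow hm).const_mul (m : ℝ)).mono'
    ((continuousOn_sech_pow_mul_tanh_div m).aestronglyMeasurable measurableSet_Ioi) ?_
  filter_upwards [ae_restrict_mem measurableSet_Ioi] with x hx
  have h0 : 0 ≤ m * sech x ^ m := mul_nonneg m.cast_nonneg (pow_nonneg (sech_pos x).le m)
  rw [mul_div_assoc, Real.norm_of_nonneg (mul_nonneg h0 (tanh_div_nonneg hx))]
  exact mul_le_of_le_one_right h0 (tanh_div_le_one hx)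

theorem integrableOn_logSechPow {m : ℕ} (hm : 2 ≤ m) : IntegrableOn (logSechPow m) (Ioi 0) := by
  have hlog : IntegrableOn (fun x => ‖Real.log x‖) (Ioc 0 1) := by
    have := (intervalIntegral.intervalIntegrable_log' (a := 0) (b := 1)).1
    exact this.norm
  have hmeas : Measurable (logSechPow m) :=
    Real.measurable_log.mul (continuous_sech.measurable.pow_const m)
  rw [← Ioc_union_Ioi_eq_Ioi zero_le_one]
  refine IntegrableOn.union ?_ ?_
  · refine hlog.mono' hmeas.aestronglyMeasurable (ae_of_all _ fun x => ?_)
    rw [logSechPow, norm_mul]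
    refine mul_le_of_le_one_right (norm_nonneg _) ?_
    change ‖sech x ^ m‖ ≤ 1
    rw [Real.norm_of_nonneg (pow_nonneg (sech_pos x).le m)]
    exact pow_le_one₀ (sech_pos x).le (sech_le_one x)
  -- Beyond 1 the logarithm is bounded by `exp x`, costing one power of sech; this is where `m ≥ 2`
  -- enters.
  · refine ((integrableOn_exp_mul_sech_pow (m := m) (t := -1) ?_).mono_set
      (Ioi_subset_Ioi zero_le_one)).mono' hmeas.aestronglyMeasurable ?_
    · have : (2 : ℝ) ≤ m := by exact_mod_cast hm
      linarith
    · filter_upwards [ae_restrict_mem measurableSet_Ioi] with x hx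
      have hx : (1 : ℝ) < x := hx
      have h0 := pow_nonneg (sech_pos x).le m
      change ‖Real.log x * sech x ^ m‖ ≤ _
      rw [norm_mul, Real.norm_of_nonneg h0, Real.norm_of_nonneg (Real.log_nonneg hx.le), neg_neg,
        one_mul]
      gcongr
      have h1 := Real.log_le_sub_one_of_pos (zero_lt_one.trans hx)
      have h2 := Real.add_one_le_exp x
      linarith

theorem hasDerivAt_sech_pow_mul_tanh (m : ℕ) (x : ℝ) :
    HasDerivAt (fun x => -(m * sech x ^ m * Real.tanh x))
      (m ^ 2 * sech x ^ m - m * (m + 1) * sech x ^ (m + 2)) x := by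
  have h := (((hasDerivAt_sech_pow m x).const_mul (m : ℝ)).mul (hasDerivAt_tanh x)).neg
  refine h.congr_deriv ?_
  have := sech_sq x
  rw [pow_add]
  linear_combination (m ^ 2 * sech x ^ m) * this

theorem tendsto_sech_pow_mul_tanh_mul_log {m : ℕ} (hm : 2 ≤ m) :
    Tendsto (fun x => Real.log x * -(m * sech x ^ m * Real.tanh x)) atTop (𝓝 0) := by
  have h : Tendsto (fun x => (m : ℝ) * (Real.exp (-(-1) * x) * sech x ^ m)) atTop
      (𝓝 (m * 0)) := by
    refine (tendsto_exp_mul_sech_pow ?_).const_mul _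
    have : (2 : ℝ) ≤ m := by exact_mod_cast hm
    linarith
  rw [mul_zero] at h
  refine squeeze_zero_norm' ?_ h
  filter_upwards [eventually_ge_atTop 1] with x hx
  have h0 := pow_nonneg (sech_pos x).le m
  have hm0 : (0 : ℝ) ≤ m := m.cast_nonneg
  rw [norm_mul, norm_neg, norm_mul, Real.norm_of_nonneg (mul_nonneg hm0 h0),
    Real.norm_of_nonneg (Real.log_nonneg hx), Real.norm_eq_abs, neg_neg, one_mul]
  have h1 : Real.log x ≤ Real.exp x := by
    have h1 := Real.log_le_sub_one_of_pos (zero_lt_one.trans_le hx)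
    have h2 := Real.add_one_le_exp x
    linarith
  calc Real.log x * (m * sech x ^ m * |Real.tanh x|)
      ≤ Real.exp x * (m * sech x ^ m * 1) := by
        gcongr
        exact (Real.abs_tanh_lt_one x).le
    _ = m * (Real.exp x * sech x ^ m) := by ring

theorem continuousAt_log_mul {f : ℝ → ℝ} {C : ℝ} (hf : ∀ x, |f x| ≤ C * |x|) :
    ContinuousAt (fun x => Real.log x * f x) 0 := by
  have h0 : f 0 = 0 := by simpa using hf 0
  have h : Tendsto (fun x : ℝ => C * |x * Real.log x|) (𝓝 0) (𝓝 0) := by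
    have := (Real.continuous_mul_log.abs.const_mul C).tendsto 0
    simpa using this
  rw [ContinuousAt, h0, mul_zero]
  refine squeeze_zero_norm (fun x => ?_) h
  rw [norm_mul, Real.norm_eq_abs, Real.norm_eq_abs, abs_mul]
  nlinarith [hf x, abs_nonneg (Real.log x)]

theorem mul_Delta_add_two {m : ℕ} (hm : 2 ≤ m) :
    (m : ℝ) * (m + 1) * Delta (m + 2) = m ^ 2 * Delta m - sechTanhDiv m := by
  have hi1 := (integrableOn_logSechPow hm).const_mul ((m : ℝ) ^ 2)
  have hi2 := (integrableOn_logSechPow (m := m + 2) (by omega)).const_mul ((m : ℝ) * (m + 1))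
  have hi3 := integrableOn_sech_pow_mul_tanh_div (m := m) (by omega)
  have hi12 : IntegrableOn (fun x => (m : ℝ) ^ 2 * logSechPow m x
      - m * (m + 1) * logSechPow (m + 2) x) (Ioi 0) := hi1.sub hi2
  have hi : IntegrableOn (fun x => (m : ℝ) ^ 2 * logSechPow m x
      - m * (m + 1) * logSechPow (m + 2) x - m * sech x ^ m * Real.tanh x / x) (Ioi 0) :=
    hi12.sub hi3
  have key := integral_Ioi_of_hasDerivAt_of_tendsto (a := 0) (m := 0)
    (f := fun x => Real.log x * -(m * sech x ^ m * Real.tanh x))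
    (f' := fun x => (m : ℝ) ^ 2 * logSechPow m x - m * (m + 1) * logSechPow (m + 2) x
      - m * sech x ^ m * Real.tanh x / x)
    (ContinuousAt.continuousWithinAt (continuousAt_log_mul (C := m) fun x => by
      rw [abs_neg, abs_mul, abs_of_nonneg (mul_nonneg m.cast_nonneg (pow_nonneg (sech_pos x).le m))]
      refine mul_le_mul (mul_le_of_le_one_right m.cast_nonneg
        (pow_le_one₀ (sech_pos x).le (sech_le_one x))) (abs_tanh_le_abs x) (abs_nonneg _)
        m.cast_nonneg))
    (fun x hx => by
      refine ((Real.hasDerivAt_log (mem_Ioi.1 hx).ne').mul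
        (hasDerivAt_sech_pow_mul_tanh m x)).congr_deriv ?_
      change _ = (m : ℝ) ^ 2 * (Real.log x * sech x ^ m)
        - m * (m + 1) * (Real.log x * sech x ^ (m + 2)) - _
      ring)
    hi (tendsto_sech_pow_mul_tanh_mul_log hm)
  rw [integral_sub hi12 hi3, integral_sub hi1 hi2, integral_const_mul, integral_const_mul] at key
  -- The default `log 0 = 0` makes the boundary term vanish, consistently with the limit given by
  -- `continuousAt_log_mul`.
  simp only [Real.log_zero, zero_mul, sub_zero] at key
  unfold Delta sechTanhDiv
  linarith

/-! ### Differences of consecutive sech-tanh integrals -/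

theorem sech_pow_sub_nonneg (k : ℕ) (x : ℝ) : 0 ≤ sech x ^ k - sech x ^ (k + 1) := by
  rw [pow_succ]
  nlinarith [pow_nonneg (sech_pos x).le k, sech_le_one x]

theorem sech_pow_sub_le (k : ℕ) (x : ℝ) :
    sech x ^ k - sech x ^ (k + 1) ≤ sech x ^ k * x ^ 2 := by
  rw [pow_succ]
  nlinarith [pow_nonneg (sech_pos x).le k, one_sub_sech_le_sq x]

theorem integrableOn_sech_pow_sub_div_sq {k : ℕ} (hk : 0 < k) :
    IntegrableOn (fun x => (sech x ^ k - sech x ^ (k + 1)) / x ^ 2) (Ioi 0) := by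
  have hc : ContinuousOn (fun x => (sech x ^ k - sech x ^ (k + 1)) / x ^ 2) (Ioi 0) := by
    have := continuous_sech
    exact ContinuousOn.div (by fun_prop) (by fun_prop)
      fun x hx => pow_ne_zero 2 (mem_Ioi.1 hx).ne'
  refine (integrableOn_sech_pow hk).mono' (hc.aestronglyMeasurable measurableSet_Ioi) ?_
  filter_upwards [ae_restrict_mem measurableSet_Ioi] with x hx
  have hx : 0 < x := hx
  rw [Real.norm_of_nonneg (div_nonneg (sech_pow_sub_nonneg k x) (sq_nonneg x)),
    div_le_iff₀ (by positivity)]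
  exact sech_pow_sub_le k x

/-- Integrate the derivative of `(sech^k - sech^(k+1)) / x`. It is at most `|x|` in absolute value,
so the default value 0 at the origin is the right limit, and it vanishes at infinity. -/
theorem sechTanhDiv_succ_sub {k : ℕ} (hk : 0 < k) :
    sechTanhDiv (k + 1) - sechTanhDiv k
      = ∫ x in Ioi (0 : ℝ), (sech x ^ k - sech x ^ (k + 1)) / x ^ 2 := by
  have hi1 := integrableOn_sech_pow_mul_tanh_div (m := k + 1) (by omega)
  have hi2 := integrableOn_sech_pow_mul_tanh_div hk
  have hi3 := integrableOn_sech_pow_sub_div_sq hk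
  have hi12 : IntegrableOn (fun x => (k + 1 : ℕ) * sech x ^ (k + 1) * Real.tanh x / x
      - k * sech x ^ k * Real.tanh x / x) (Ioi 0) := hi1.sub hi2
  have hle : ∀ x : ℝ, ‖(sech x ^ k - sech x ^ (k + 1)) / x‖ ≤ |x| := by
    intro x
    rcases eq_or_ne x 0 with rfl | hx
    · simp
    rw [norm_div, Real.norm_of_nonneg (sech_pow_sub_nonneg k x), Real.norm_eq_abs,
      div_le_iff₀ (abs_pos.2 hx), abs_mul_abs_self, ← sq]
    refine (sech_pow_sub_le k x).trans (mul_le_of_le_one_left (sq_nonneg x) ?_)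
    exact pow_le_one₀ (sech_pos x).le (sech_le_one x)
  have hinf : Tendsto (fun x => (sech x ^ k - sech x ^ (k + 1)) / x) atTop (𝓝 0) := by
    refine squeeze_zero_norm' ?_ (tendsto_inv_atTop_zero (𝕜 := ℝ))
    filter_upwards [eventually_gt_atTop 0] with x hx
    rw [norm_div, Real.norm_of_nonneg (sech_pow_sub_nonneg k x), Real.norm_of_nonneg hx.le,
      div_eq_mul_inv]
    refine mul_le_of_le_one_left (by positivity) ?_
    have h1 : sech x ^ k ≤ 1 := pow_le_one₀ (sech_pos x).le (sech_le_one x)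
    have h2 := pow_nonneg (sech_pos x).le (k + 1)
    linarith
  have key := integral_Ioi_of_hasDerivAt_of_tendsto (a := 0) (m := 0)
    (f := fun x => (sech x ^ k - sech x ^ (k + 1)) / x)
    (f' := fun x => ((k + 1 : ℕ) * sech x ^ (k + 1) * Real.tanh x / x
      - k * sech x ^ k * Real.tanh x / x) - (sech x ^ k - sech x ^ (k + 1)) / x ^ 2)
    (ContinuousAt.continuousWithinAt (by
      rw [ContinuousAt, div_zero]
      refine squeeze_zero_norm hle ?_
      simpa using (continuous_abs (G := ℝ)).tendsto 0))
    (fun x hx => by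
      have hx : x ≠ 0 := (mem_Ioi.1 hx).ne'
      refine (((hasDerivAt_sech_pow k x).sub (hasDerivAt_sech_pow (k + 1) x)).div
        (hasDerivAt_id x) hx).congr_deriv ?_
      simp only [id, Pi.sub_apply]
      field_simp
      ring)
    (hi12.sub hi3) hinf
  simp only [div_zero, sub_zero] at key
  rw [integral_sub hi12 hi3, integral_sub hi1 hi2] at key
  unfold sechTanhDiv
  linarith

/-! ### Averaging over the unit square -/

theorem integral_exp_neg_mul {x : ℝ} (hx : x ≠ 0) :
    ∫ a in Ioc (0 : ℝ) 1, Real.exp (-(a * x)) = (1 - Real.exp (-x)) / x := by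
  rw [← intervalIntegral.integral_of_le zero_le_one]
  have hd : ∀ a ∈ uIcc (0 : ℝ) 1, HasDerivAt (fun a => -Real.exp (-(a * x)) / x)
      (Real.exp (-(a * x))) a := by
    intro a _
    have h : HasDerivAt (fun a => Real.exp (-(a * x))) (Real.exp (-(a * x)) * -(1 * x)) a :=
      ((hasDerivAt_id a).mul_const x).neg.exp
    refine (h.neg.div_const x).congr_deriv ?_
    field_simp
  rw [intervalIntegral.integral_eq_sub_of_hasDerivAt hd
    (Continuous.intervalIntegrable (by fun_prop) _ _)]
  simp
  ring

theorem ae_add_ne_intCast (μ ν : Measure ℝ) [SFinite μ] [SFinite ν] [NullSingletonClass ν] :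
    ∀ᵐ p : ℝ × ℝ ∂(μ.prod ν), ∀ m : ℤ, p.1 + p.2 - 1 ≠ m := by
  rw [ae_all_iff]
  intro m
  have hmeas : MeasurableSet {p : ℝ × ℝ | p.1 + p.2 - 1 ≠ m} :=
    (measurableSet_eq_fun (by fun_prop) measurable_const).compl
  rw [Measure.ae_prod_iff_ae_ae hmeas]
  refine ae_of_all _ fun a => ?_
  filter_upwards [compl_mem_ae_iff.2 (measure_singleton (μ := ν) (m + 1 - a))] with b hb h
  exact hb (by simp only [mem_singleton_iff]; linarith)

/-- Lebesgue measure on the unit square. -/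
noncomputable def squareMeasure : Measure (ℝ × ℝ) :=
  (volume.restrict (Ioc 0 1)).prod (volume.restrict (Ioc 0 1))

instance : IsFiniteMeasure squareMeasure := by unfold squareMeasure; infer_instance

theorem squareMeasure_eq_restrict :
    squareMeasure = volume.restrict (Icc (0 : ℝ) 1 ×ˢ Icc (0 : ℝ) 1) := by
  rw [squareMeasure, Measure.restrict_congr_set Ioc_ae_eq_Icc, Measure.prod_restrict,
    Measure.volume_eq_prod]

theorem ae_mem_square : ∀ᵐ p ∂squareMeasure, p ∈ Ioc (0 : ℝ) 1 ×ˢ Ioc (0 : ℝ) 1 := by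
  rw [squareMeasure, Measure.prod_restrict]
  exact ae_restrict_mem (measurableSet_Ioc.prod measurableSet_Ioc)

theorem integrable_exp_mul_sech_pow_prod {k : ℕ} (hk : 0 < k) :
    Integrable (Function.uncurry fun (p : ℝ × ℝ) (x : ℝ) =>
      Real.exp (-(p.1 + p.2 - 1) * x) * sech x ^ (k + 1))
      (squareMeasure.prod (volume.restrict (Ioi 0))) := by
  have hk1 : (1 : ℝ) ≤ k := by exact_mod_cast hk
  -- On the square `a + b - 1 > -1`, so `exp x * sech^(k+1) x` dominates; it is integrable because
  -- `k ≥ 1`.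
  have hb : Integrable (fun q : (ℝ × ℝ) × ℝ =>
      (1 : ℝ) * (Real.exp (-(-1) * q.2) * sech q.2 ^ (k + 1)))
      (squareMeasure.prod (volume.restrict (Ioi 0))) :=
    (integrable_const (1 : ℝ)).mul_prod
      (integrableOn_exp_mul_sech_pow (by push_cast; linarith))
  have hc := continuous_sech
  refine hb.mono' (by
    unfold Function.uncurry
    exact (by fun_prop : Continuous fun q : (ℝ × ℝ) × ℝ =>
      Real.exp (-(q.1.1 + q.1.2 - 1) * q.2) * sech q.2 ^ (k + 1)).aestronglyMeasurable) ?_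
  rw [squareMeasure, Measure.prod_restrict, Measure.prod_restrict]
  filter_upwards [ae_restrict_mem
    ((measurableSet_Ioc.prod measurableSet_Ioc).prod measurableSet_Ioi)] with q hq
  obtain ⟨⟨⟨h1, -⟩, ⟨h2, -⟩⟩, h3⟩ := hq
  have h3 : 0 < q.2 := h3
  rw [Function.uncurry, Real.norm_of_nonneg (exp_mul_sech_pow_nonneg _ _ _), one_mul]
  refine mul_le_mul_of_nonneg_right (Real.exp_le_exp.2 ?_) (pow_nonneg (sech_pos _).le _)
  refine mul_le_mul_of_nonneg_right ?_ h3.le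
  linarith

/-- The exponential factors in `a` and `b`, and `exp x * (1 - exp (-x))² = 2 cosh x - 2`. -/
theorem integral_square_exp_mul_sech_pow (k : ℕ) {x : ℝ} (hx : x ≠ 0) :
    ∫ p, Real.exp (-(p.1 + p.2 - 1) * x) * sech x ^ (k + 1) ∂squareMeasure
      = 2 * ((sech x ^ k - sech x ^ (k + 1)) / x ^ 2) := by
  have h : ∀ p : ℝ × ℝ, Real.exp (-(p.1 + p.2 - 1) * x) * sech x ^ (k + 1)
      = Real.exp x * sech x ^ (k + 1) * (Real.exp (-(p.1 * x)) * Real.exp (-(p.2 * x))) := by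
    intro p
    rw [show -(p.1 + p.2 - 1) * x = x + (-(p.1 * x) + -(p.2 * x)) by ring, Real.exp_add,
      Real.exp_add]
    ring
  simp_rw [h]
  rw [integral_const_mul, squareMeasure,
    integral_prod_mul (fun a => Real.exp (-(a * x))) (fun b => Real.exp (-(b * x))),
    integral_exp_neg_mul hx]
  have h1 := sech_mul_cosh x
  rw [Real.cosh_eq] at h1
  have h2 : Real.exp x * Real.exp (-x) = 1 := by rw [← Real.exp_add]; simp
  rw [pow_succ]
  field_simp
  linear_combination sech x ^ k * ((Real.exp (-x) * sech x - 2 * sech x) * h2 + 2 * h1)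

theorem integrable_sechLaplace_add {k : ℕ} (hk : 0 < k) :
    Integrable (fun p : ℝ × ℝ => sechLaplace (k + 1) (p.1 + p.2 - 1)) squareMeasure :=
  (integrable_exp_mul_sech_pow_prod hk).integral_prod_left

theorem integral_sechLaplace_add {k : ℕ} (hk : 0 < k) :
    ∫ p, sechLaplace (k + 1) (p.1 + p.2 - 1) ∂squareMeasure
      = 2 * (sechTanhDiv (k + 1) - sechTanhDiv k) := by
  unfold sechLaplace
  rw [integral_integral_swap (integrable_exp_mul_sech_pow_prod hk), sechTanhDiv_succ_sub hk,
    ← integral_const_mul]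
  exact setIntegral_congr_fun measurableSet_Ioi fun x hx =>
    integral_square_exp_mul_sech_pow k (mem_Ioi.1 hx).ne'

theorem kernel_ae_eq_sechLaplace (k : ℕ) :
    (fun p : ℝ × ℝ => kernel k p.1 p.2) =ᵐ[squareMeasure]
      fun p => -(sechLaplace (k + 1) (p.1 + p.2 - 1) / 2) := by
  filter_upwards [ae_mem_square, ae_add_ne_intCast (volume.restrict (Ioc 0 1))
    (volume.restrict (Ioc 0 1))] with p hp hne
  obtain ⟨⟨h1, -⟩, ⟨h2, -⟩⟩ := hp
  have hk : (0 : ℝ) ≤ k := k.cast_nonneg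
  rw [kernel_eq_kernel_add, ← kernel_eq_sechLaplace k hne (by linarith), sub_add_cancel]

theorem integrable_kernel {k : ℕ} (hk : 0 < k) :
    Integrable (fun p : ℝ × ℝ => kernel k p.1 p.2) squareMeasure :=
  ((integrable_sechLaplace_add hk).div_const 2).neg.congr (kernel_ae_eq_sechLaplace k).symm

theorem integral_integral_kernel {k : ℕ} (hk : 0 < k) :
    ∫ b in (0 : ℝ)..1, ∫ a in (0 : ℝ)..1, kernel k a b = sechTanhDiv k - sechTanhDiv (k + 1) := by
  simp_rw [intervalIntegral.integral_of_le zero_le_one]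
  rw [← integral_prod_symm (fun p : ℝ × ℝ => kernel k p.1 p.2) (integrable_kernel hk)]
  change ∫ p, kernel k p.1 p.2 ∂squareMeasure = _
  rw [integral_congr_ae (kernel_ae_eq_sechLaplace k), integral_neg, integral_div,
    integral_sechLaplace_add hk]
  ring

theorem sum_integral_kernel (N : ℕ) :
    ∑ k ∈ Finset.Icc 1 N, ∫ b in (0 : ℝ)..1, ∫ a in (0 : ℝ)..1, kernel k a b
      = sechTanhDiv 1 - sechTanhDiv (N + 1) := by
  induction N with
  | zero => simp
  | succ N ih =>
    rw [Finset.sum_Icc_succ_top (by omega), ih, integral_integral_kernel (by omega)]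
    ring

end SechLog

theorem proposition4p1 (n : ℕ) (hn : 4 ≤ n) :
    -- all the integrals in the formula converge absolutely
    MeasureTheory.IntegrableOn (SechLog.logSechPow n) (Set.Ioi 0) ∧
    MeasureTheory.IntegrableOn (SechLog.logSechPow (n - 2)) (Set.Ioi 0) ∧
    (∀ k ∈ Finset.Icc 1 (n - 3),
      MeasureTheory.IntegrableOn (fun p : ℝ × ℝ => SechLog.kernel k p.1 p.2)
        (Set.Icc (0 : ℝ) 1 ×ˢ Set.Icc (0 : ℝ) 1)) ∧
    -- the reduction formula
    SechLog.Delta n =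
      -(4 * SechLog.catalanConstant) / (Real.pi * ((n : ℝ) - 2) * ((n : ℝ) - 1)) +
        ((n : ℝ) - 2) / ((n : ℝ) - 1) * SechLog.Delta (n - 2) +
        1 / (((n : ℝ) - 2) * ((n : ℝ) - 1)) *
          ∑ k ∈ Finset.Icc 1 (n - 3),
            ∫ b in (0 : ℝ)..1, ∫ a in (0 : ℝ)..1, SechLog.kernel k a b := by
  refine ⟨SechLog.integrableOn_logSechPow (by omega), SechLog.integrableOn_logSechPow (by omega),
    fun k hk => ?_, ?_⟩
  · rw [MeasureTheory.IntegrableOn, ← SechLog.squareMeasure_eq_restrict]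
    exact SechLog.integrable_kernel (Finset.mem_Icc.1 hk).1
  · obtain ⟨m, rfl⟩ : ∃ m, n = m + 2 := ⟨n - 2, by omega⟩
    have hm : 2 ≤ m := by omega
    have key := SechLog.mul_Delta_add_two hm
    -- The sum up to `n - 3` telescopes to `S_1 - S_(n-2)`; its `S_1` cancels the explicit Catalan
    -- term.
    rw [SechLog.sum_integral_kernel, show m + 2 - 3 + 1 = m by omega, SechLog.sechTanhDiv_one,
      show m + 2 - 2 = m by omega]
    have h0 : (m : ℝ) ≠ 0 := by exact_mod_cast (by omega : m ≠ 0)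
    have h1 : (m : ℝ) + 1 ≠ 0 := by positivity
    have hpi := Real.pi_ne_zero
    rw [show ((m + 2 : ℕ) : ℝ) - 2 = m by push_cast; ring,
      show ((m + 2 : ℕ) : ℝ) - 1 = m + 1 by push_cast; ring]
    rw [mul_comm, ← eq_div_iff (mul_ne_zero h0 h1)] at key
    rw [key]
    field_simp
    ring
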